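/- Let $(R,\mathfrak m,\kappa)$ be a Noetherian local domain of Krull dimension $n$ which is analytically irreducible, i.e. its $\mathfrak m$-adic completion is a domain. A real valuation on $R$ centered at $\mathfrak m$ is a function $v\colon R\to\mathbb R_{\ge 0}\cup\{+\infty\}$ with $v(-f)=v(f)$, $v(f+g)\ge\min\{v(f),v(g)\}$, $v(fg)=v(f)+v(g)$, $v(f)=+\infty$ if and only if $f=0$, and $v(f)>0$ if and only if $f\in\mathfrak m$. It is divisorial if the residue field of its valuation ring in $\mathrm{Frac}(R)$ has transcendence degree $n-1$ over $\kappa$; $\mathrm{DivVal}_{R,\mathfrak m}$ is the set of divisorial valuations. For an ideal $I$ put $v(I)=\min_{f\in I}v(f)$, and write $\overline I$ for the integral closure of $I$. An $\mathfrak m$-filtration is a family $\mathfrak a_\bullet=(\mathfrak a_\lambda)_{\lambda\in\mathbb R_{>0}}$ of $\mathfrak m$-primary ideals that is decreasing, left continuous ($\mathfrak a_{\lambda-\epsilon}=\mathfrak a_\lambda$ for $0<\epsilon\ll1$) and multiplicative ($\mathfrak a_\lambda\mathfrak a_\mu\subset\mathfrak a_{\lambda+\mu}$); put $v(\mathfrak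 a_\bullet)=\lim_{\lambda\to\infty}v(\mathfrak a_\lambda)/\lambda$. Its saturation $\widetilde{\mathfrak a}_\bullet$ is given by $$\widetilde{\mathfrak a}_\lambda=\{f\in\mathfrak m\mid v(f)\ge\lambda\, v(\mathfrak a_\bullet)\text{ for all }v\in\mathrm{DivVal}_{R,\mathfrak m}\},\qquad \lambda>0.$$ Let $\mathfrak a$ be an $\mathfrak m$-primary ideal of $R$, and let $\mathfrak a^\bullet=(\mathfrak a^{\lceil\lambda\rceil})_{\lambda>0}$ be the $\mathfrak a$-adic filtration. Let $\mathrm{RV}(\mathfrak a)$ be the set of Rees valuations of $\mathfrak a$: identifying a valuation with its positive real multiples, it is the smallest finite set $S\subset\mathrm{DivVal}_{R,\mathfrak m}$ such that $$\overline{\mathfrak a^m}=\{f\in R\mid v(f)\ge m\,v(\mathfrak a)\text{ for all }v\in S\}\quad\text{for all }m\in\mathbb Z_{>0},$$ that is, the intersection of all such finite sets. Then $$\widetilde{\mathfrak a^\bullet}=\bigcap_{v\in\mathrm{RV}(\mathfrak a)}\mathfrak a_\bullet\!\left(\frac{v}{v(\mathfrak a)}\right),$$ an equality of $\mathfrak m$-filtrations;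 that is, for every $\lambda>0$, $$\bigl(\widetilde{\mathfrak a^\bullet}\bigr)_\lambda=\{f\in\mathfrak m\mid v(f)\ge\lambda\,v(\mathfrak a)\text{ for all }v\in\mathrm{RV}(\mathfrak a)\}.$$ -/

import Mathlib

open IsLocalRing Filter
open scoped ENNReal NNReal

noncomputable section

universe u

/-- An ideal `I` of a local ring with maximal ideal `𝔪` is `𝔪`-primary. -/
def IsMPrimary {R : Type u} [CommRing R] [IsLocalRing R] (I : Ideal R) : Prop :=
  I.IsPrimary ∧ I.radical = maximalIdeal R

/-- An `𝔪`-filtration: a family `(𝔞_t)` of `𝔪`-primary ideals indexed by the real numbers `t > 0`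
which is decreasing, left continuous and multiplicative. (Only the values at `t > 0` matter.) -/
structure MFiltration (R : Type u) [CommRing R] [IsLocalRing R] where
  ideal : ℝ → Ideal R
  isMPrimary : ∀ t, 0 < t → IsMPrimary (ideal t)
  anti : ∀ s t, 0 < s → s < t → ideal t ≤ ideal s
  leftCts : ∀ t, 0 < t → ∃ δ, 0 < δ ∧ δ ≤ t ∧ ∀ ε, 0 < ε → ε < δ → ideal (t - ε) = ideal t
  mul_le : ∀ s t, 0 < s → 0 < t → ideal s * ideal t ≤ ideal (s + t)

theorem IsMPrimary.pow {R : Type u} [CommRing R] [IsLocalRing R] {I : Ideal R}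
    (hI : IsMPrimary I) {k : ℕ} (hk : k ≠ 0) : IsMPrimary (I ^ k) := by
  have h : (I ^ k).radical = maximalIdeal R := by rw [Ideal.radical_pow I hk, hI.2]
  refine ⟨Ideal.isPrimary_of_isMaximal_radical ?_, h⟩
  rw [h]; infer_instance

/-- The `𝔞`-adic filtration `𝔞^•`, with `𝔞_t = 𝔞 ^ ⌈t⌉`. -/
def adicFiltration {R : Type u} [CommRing R] [IsLocalRing R] (I : Ideal R) (hI : IsMPrimary I) :
    MFiltration R where
  ideal t := I ^ ⌈t⌉₊
  isMPrimary t ht := hI.pow (Nat.ceil_pos.2 ht).ne'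
  anti s t _ hst := Ideal.pow_le_pow_right (Nat.ceil_mono hst.le)
  leftCts t ht := by
    have h1 : 0 < ⌈t⌉₊ := Nat.ceil_pos.2 ht
    have h2 : ((⌈t⌉₊ : ℝ)) < t + 1 := Nat.ceil_lt_add_one ht.le
    have h3 : (1 : ℝ) ≤ ⌈t⌉₊ := by exact_mod_cast h1
    refine ⟨t - (⌈t⌉₊ - 1), by linarith, by linarith, fun ε h0 hε => ?_⟩
    have h4 : ⌈t - ε⌉₊ = ⌈t⌉₊ := by
      apply le_antisymm (Nat.ceil_mono (by linarith))
      have : ⌈t⌉₊ - 1 < ⌈t - ε⌉₊ := by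
        rw [Nat.lt_ceil, Nat.cast_sub h1]
        push_cast
        linarith
      omega
    simp only [h4]
  mul_le s t _ _ := by
    rw [← pow_add]
    exact Ideal.pow_le_pow_right (Nat.ceil_add_le s t)

/-- A real valuation on a local domain `R`, centered at the maximal ideal `𝔪`, written additively:
a multiplicative `𝔪`-norm `R → ℝ≥0 ∪ {+∞}`. -/
structure RealValuation (R : Type u) [CommRing R] [IsLocalRing R] where
  toFun : R → ℝ≥0∞
  map_neg : ∀ f, toFun (-f) = toFun f
  min_le_map_add : ∀ f g, min (toFun f) (toFun g) ≤ toFun (f + g)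
  map_mul : ∀ f g, toFun (f * g) = toFun f + toFun g
  eq_top_iff : ∀ f, toFun f = ⊤ ↔ f = 0
  pos_iff : ∀ f, 0 < toFun f ↔ f ∈ maximalIdeal R

namespace RealValuation

instance {R : Type u} [CommRing R] [IsLocalRing R] :
    CoeFun (RealValuation R) (fun _ => R → ℝ≥0∞) := ⟨toFun⟩

theorem map_zero {R : Type u} [CommRing R] [IsLocalRing R] (v : RealValuation R) : v 0 = ⊤ :=
  (v.eq_top_iff 0).2 rfl

theorem map_one {R : Type u} [CommRing R] [IsLocalRing R] (v : RealValuation R) : v 1 = 0 := by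
  by_contra h
  have h1 := (v.pos_iff 1).1 (pos_iff_ne_zero.2 h)
  exact (Ideal.ne_top_iff_one _).1 (maximalIdeal.isMaximal R).ne_top h1

theorem cancel {R : Type u} [CommRing R] [IsLocalRing R] (v : RealValuation R) {f g b : R}
    (hb : b ≠ 0) (h : v (b * f) ≤ v (b * g)) : v f ≤ v g := by
  rw [v.map_mul, v.map_mul] at h
  exact (ENNReal.add_le_add_iff_left (fun h' => hb ((v.eq_top_iff b).1 h'))).1 h

/-- The valuation ring `{f / g | g ≠ 0, v f ≥ v g}` of `v` in the fraction field of `R`. -/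
def valuationRing {R : Type u} [CommRing R] [IsDomain R] [IsLocalRing R] (v : RealValuation R) :
    ValuationSubring (FractionRing R) where
  carrier := {x | ∃ f g : R, g ≠ 0 ∧
    x = algebraMap R (FractionRing R) f / algebraMap R (FractionRing R) g ∧ v g ≤ v f}
  mul_mem' := by
    rintro _ _ ⟨f, g, hg, rfl, h⟩ ⟨f', g', hg', rfl, h'⟩
    refine ⟨f * f', g * g', mul_ne_zero hg hg', ?_, ?_⟩
    · rw [_root_.map_mul, _root_.map_mul, div_mul_div_comm]
    · rw [v.map_mul, v.map_mul]; exact add_le_add h h'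
  one_mem' := ⟨1, 1, one_ne_zero, by simp, le_rfl⟩
  add_mem' := by
    rintro _ _ ⟨f, g, hg, rfl, h⟩ ⟨f', g', hg', rfl, h'⟩
    have i : ∀ {x : R}, x ≠ 0 → algebraMap R (FractionRing R) x ≠ 0 := fun hx =>
      (map_ne_zero_iff _ (IsFractionRing.injective R (FractionRing R))).2 hx
    refine ⟨f * g' + g * f', g * g', mul_ne_zero hg hg', ?_, ?_⟩
    · rw [div_add_div _ _ (i hg) (i hg')]; simp only [_root_.map_mul, _root_.map_add]
    · refine le_trans ?_ (v.min_le_map_add _ _)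
      rw [v.map_mul, v.map_mul, v.map_mul]
      exact le_min (by gcongr) (by gcongr)
  zero_mem' := ⟨0, 1, one_ne_zero, by simp, by rw [v.map_zero]; exact le_top⟩
  neg_mem' := by
    rintro _ ⟨f, g, hg, rfl, h⟩
    exact ⟨-f, g, hg, by rw [_root_.map_neg, neg_div], by rwa [v.map_neg]⟩
  mem_or_inv_mem' := by
    intro x
    obtain ⟨f, g, hg, rfl⟩ := IsFractionRing.div_surjective (A := R) x
    have hg0 : g ≠ 0 := nonZeroDivisors.ne_zero hg
    by_cases hf : f = 0
    · exact Or.inl ⟨f, g, hg0, rfl, by rw [hf, v.map_zero]; exact le_top⟩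
    · rcases le_total (v g) (v f) with h | h
      · exact Or.inl ⟨f, g, hg0, rfl, h⟩
      · exact Or.inr ⟨g, f, hf, by rw [inv_div], h⟩

theorem algebraMap_mem {R : Type u} [CommRing R] [IsDomain R] [IsLocalRing R]
    (v : RealValuation R) (f : R) : algebraMap R (FractionRing R) f ∈ v.valuationRing :=
  ⟨f, 1, one_ne_zero, by simp, by rw [v.map_one]; exact zero_le⟩

/-- The inclusion of `R` into the valuation ring of `v`. -/
def toValuationRing {R : Type u} [CommRing R] [IsDomain R] [IsLocalRing R]
    (v : RealValuation R) : R →+* v.valuationRing :=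
  (algebraMap R (FractionRing R)).codRestrict v.valuationRing v.algebraMap_mem

instance {R : Type u} [CommRing R] [IsDomain R] [IsLocalRing R] (v : RealValuation R) :
    IsLocalHom v.toValuationRing where
  map_nonunit := by
    intro r hr
    obtain ⟨⟨y, f, g, hg, hy, h⟩, hz⟩ := hr.exists_right_inv
    have h1 : algebraMap R (FractionRing R) r * y = 1 := congrArg Subtype.val hz
    have hg' : algebraMap R (FractionRing R) g ≠ 0 :=
      (map_ne_zero_iff _ (IsFractionRing.injective R (FractionRing R))).2 hg
    have h2 : r * f = g := by
      apply IsFractionRing.injective R (FractionRing R)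
      rw [hy] at h1
      rw [_root_.map_mul]
      field_simp at h1
      exact h1
    have h3 : v r = 0 := by
      have h4 : v (f * r) ≤ v (f * 1) := by rwa [mul_comm, h2, mul_one]
      have hf : f ≠ 0 := by rintro rfl; exact hg (by rw [← h2, mul_zero])
      have := v.cancel hf h4
      rwa [v.map_one, nonpos_iff_eq_zero] at this
    by_contra hu
    exact ((v.pos_iff r).2 ((mem_maximalIdeal r).2 hu)).ne' h3

/-- The residue field `κ_v` of (the valuation ring of) `v`. -/
abbrev residueField {R : Type u} [CommRing R] [IsDomain R] [IsLocalRing R]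
    (v : RealValuation R) : Type u := ResidueField v.valuationRing

/-- `κ_v` is an extension of the residue field `κ` of `R`. -/
instance algebraResidueField {R : Type u} [CommRing R] [IsDomain R] [IsLocalRing R]
    (v : RealValuation R) : Algebra (ResidueField R) v.residueField :=
  (ResidueField.map v.toValuationRing).toAlgebra

/-- `v` is divisorial: `tr.deg_κ (κ_v) = n - 1`, where `n` is the Krull dimension of `R`
(written without subtraction). -/
def IsDivisorial {R : Type u} [CommRing R] [IsDomain R] [IsLocalRing R]
    (v : RealValuation R) : Prop :=
  ∃ d : ℕ, Algebra.trdeg (ResidueField R) v.residueField = d ∧ ringKrullDim R = d + 1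

/-- `v(I) = min {v(f) | f ∈ I}` for an ideal `I`. -/
def onIdeal {R : Type u} [CommRing R] [IsLocalRing R] (v : RealValuation R) (I : Ideal R) : ℝ≥0∞ :=
  ⨅ f ∈ I, v f

/-- `v(𝔞_•) = lim_{t → ∞} v(𝔞_t) / t` for an `𝔪`-filtration `𝔞_•`. (The limit always exists, by
subadditivity of `t ↦ v(𝔞_t)`.) -/
def onFiltration {R : Type u} [CommRing R] [IsLocalRing R] (v : RealValuation R)
    (𝔞 : MFiltration R) : ℝ≥0∞ :=
  limUnder atTop (fun t : ℝ => v.onIdeal (𝔞.ideal t) / ENNReal.ofReal t)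

/-- The ideal `𝔞_t(v / c) = {f ∈ R | v(f) / c ≥ t}` of the rescaled valuation `v / c`
(the condition is written as `t * c ≤ v(f)`, which is the same for `0 < c < ∞`). -/
def scaledIdeal {R : Type u} [CommRing R] [IsLocalRing R] (v : RealValuation R) (c : ℝ≥0∞)
    (t : ℝ) : Ideal R where
  carrier := {f | ENNReal.ofReal t * c ≤ v f}
  add_mem' := fun hf hg => (le_min hf hg).trans (v.min_le_map_add _ _)
  zero_mem' := by
    simp only [Set.mem_ofPred_eq, v.map_zero]
    exact le_top
  smul_mem' := by
    intro r f hf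
    simp only [Set.mem_ofPred_eq, smul_eq_mul, v.map_mul] at hf ⊢
    exact hf.trans le_add_self

/-- `v` and `w` agree up to scaling: `w = c * v` for some real number `c > 0`. -/
def IsEquiv {R : Type u} [CommRing R] [IsLocalRing R] (v w : RealValuation R) : Prop :=
  ∃ c : ℝ≥0, c ≠ 0 ∧ ∀ f, w f = c * v f

end RealValuation

/-- The saturation of an `𝔪`-filtration `𝔞_•`: its ideal at `t` consists of the `f ∈ 𝔪` with
`v(f) ≥ t * v(𝔞_•)` for all divisorial valuations `v`. -/
def MFiltration.saturation {R : Type u} [CommRing R] [IsDomain R] [IsLocalRing R]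
    (𝔞 : MFiltration R) (t : ℝ) : Ideal R where
  carrier := {f | f ∈ maximalIdeal R ∧
    ∀ v : RealValuation R, v.IsDivisorial → ENNReal.ofReal t * v.onFiltration 𝔞 ≤ v f}
  add_mem' := fun hf hg => ⟨Ideal.add_mem _ hf.1 hg.1, fun v hv =>
    (le_min (hf.2 v hv) (hg.2 v hv)).trans (v.min_le_map_add _ _)⟩
  zero_mem' := ⟨Ideal.zero_mem _, fun v _ => by rw [v.map_zero]; exact le_top⟩
  smul_mem' := by
    rintro r f ⟨hf, h⟩
    refine ⟨Ideal.mul_mem_left _ r hf, fun v hv => ?_⟩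
    rw [smul_eq_mul, v.map_mul]
    exact (h v hv).trans le_add_self

/-- `f` lies in the integral closure of the ideal `I`: there are `k ≥ 1` and `c_i ∈ I ^ i` with
`f ^ k + c_1 f ^ (k - 1) + ⋯ + c_k = 0`. -/
def IsIntegralOverIdeal {R : Type u} [CommRing R] (I : Ideal R) (f : R) : Prop :=
  ∃ k : ℕ, 1 ≤ k ∧ ∃ c : ℕ → R, (∀ i ∈ Finset.Icc 1 k, c i ∈ I ^ i) ∧
    f ^ k + ∑ i ∈ Finset.Icc 1 k, c i * f ^ (k - i) = 0

/-- `S` is a set of divisorial valuations which computes the integral closures of all powers of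
`I`: for every integer `m ≥ 1`, the integral closure of `I ^ m` is
`{f | v(f) ≥ m * v(I) for all v ∈ S}`. -/
def ComputesIntegralClosures {R : Type u} [CommRing R] [IsDomain R] [IsLocalRing R]
    (I : Ideal R) (S : Set (RealValuation R)) : Prop :=
  (∀ v ∈ S, v.IsDivisorial) ∧
    ∀ m : ℕ, 1 ≤ m → ∀ f : R, IsIntegralOverIdeal (I ^ m) f ↔ ∀ v ∈ S, m * v.onIdeal I ≤ v f

/-- The Rees valuations of `I`, where a valuation is identified with its positive multiples: the
smallest finite set of divisorial valuations that computes the integral closures of all powers of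
`I`. So a divisorial valuation is a Rees valuation if, up to scaling, it belongs to every such
finite set. As a set of functions, `reesValuations I` is closed under scaling. -/
def reesValuations {R : Type u} [CommRing R] [IsDomain R] [IsLocalRing R]
    (I : Ideal R) : Set (RealValuation R) :=
  {v | v.IsDivisorial ∧ ∀ S : Set (RealValuation R), S.Finite → ComputesIntegralClosures I S →
    ∃ w ∈ S, w.IsEquiv v}

end

/-! Dividing by `v(I)` turns the valuations with `v(I) ≠ 0` into additive functions on `R \ {0}`;
two of them agree exactly when the valuations differ by a scalar. If `S` is a finite set that
computes the integral closures of the powers of `I`, then the pointwise minimum of the normalized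
valuations of `S` is at most the normalization of any valuation `w` centered at `𝔪`: otherwise some
`f ^ n` is integral over some `I ^ p` with `p * w(I) > n * w(f)`. In particular,
all such `S` have the same pointwise minimum. A finite set of additive functions that is
minimal for its pointwise minimum is contained in every finite set with that minimum: if `φ` is
strictly the smallest member at `f`, then `φ` is the minimum at `x + k • f` for all large `k`. So a
minimal subset of `S` consists of Rees valuations, and the Rees valuations bound every `w`. -/

open Topology nonZeroDivisors

section LowerEnvelope

variable {M Γ : Type*} [AddZeroClass M] [AddZeroClass Γ] [Preorder Γ]

/-- The pointwise infimum of the family `T` of additive functions is at most that of `S`. For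
finite `T` the infimum is attained, so it need not be mentioned. -/
def LowerEnvelopeLE (T S : Set (M →+ Γ)) : Prop :=
  ∀ φ ∈ S, ∀ x, ∃ ψ ∈ T, ψ x ≤ φ x

namespace LowerEnvelopeLE

variable {S T U : Set (M →+ Γ)}

theorem of_subset (h : S ⊆ T) : LowerEnvelopeLE T S :=
  fun φ hφ _ => ⟨φ, h hφ, le_rfl⟩

theorem trans (hTS : LowerEnvelopeLE T S) (hSU : LowerEnvelopeLE S U) : LowerEnvelopeLE T U := by
  intro φ hφ x
  obtain ⟨ψ, hψ, hle⟩ := hSU φ hφ x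
  obtain ⟨χ, hχ, hle'⟩ := hTS ψ hψ x
  exact ⟨χ, hχ, hle'.trans hle⟩

theorem le_of_forall_le (hTS : LowerEnvelopeLE T S) {c : Γ} {x : M} (h : ∀ ψ ∈ T, c ≤ ψ x) :
    ∀ φ ∈ S, c ≤ φ x := by
  intro φ hφ
  obtain ⟨ψ, hψ, hle⟩ := hTS φ hφ x
  exact (h ψ hψ).trans hle

end LowerEnvelopeLE

end LowerEnvelope

theorem mem_of_forall_le_of_forall_exists_le {M Γ : Type*} [AddCommMonoid M] [AddCommMonoid Γ]
    [PartialOrder Γ] [IsOrderedCancelAddMonoid Γ] {T : Set (M →+ Γ)} {φ : M →+ Γ} (hT : T.Finite)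
    (hle : ∀ ψ ∈ T, ∀ x, φ x ≤ ψ x) (hex : ∀ x, ∃ ψ ∈ T, ψ x ≤ φ x) : φ ∈ T := by
  by_contra hφ
  have hlt : ∀ ψ ∈ T, ∃ x, φ x < ψ x := by
    intro ψ hψ
    obtain ⟨x, hx⟩ := DFunLike.exists_ne (ne_of_mem_of_not_mem hψ hφ)
    exact ⟨x, (hle ψ hψ x).lt_of_ne hx.symm⟩
  choose! g hg using hlt
  obtain ⟨ψ, hψ, hsum⟩ := hex (∑ χ ∈ hT.toFinset, g χ)
  refine hsum.not_gt ?_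
  rw [map_sum, map_sum]
  exact Finset.sum_lt_sum (fun χ _ => hle ψ hψ (g χ)) ⟨ψ, hT.mem_toFinset.2 hψ, hg ψ hψ⟩

section Archimedean

variable {M Γ : Type*} [AddCommMonoid M] [AddCommGroup Γ] [LinearOrder Γ] [IsOrderedAddMonoid Γ]
  [Archimedean Γ] {S T : Set (M →+ Γ)} {φ : M →+ Γ}

theorem eventually_map_add_nsmul_lt {ψ : M →+ Γ} {f : M} (h : φ f < ψ f) (x : M) :
    ∀ᶠ k : ℕ in atTop, φ (x + k • f) < ψ (x + k • f) := by
  have : Nontrivial Γ := ⟨_, _, h.ne⟩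
  filter_upwards [(tendsto_id.atTop_nsmul_const (sub_pos.2 h)).eventually_gt_atTop (φ x - ψ x)]
    with k hk
  rw [id, nsmul_sub, sub_lt_sub_iff, add_comm (k • ψ f)] at hk
  simpa only [map_add, map_nsmul] using hk

theorem eventually_forall_map_add_nsmul_lt (hT : T.Finite) (f x : M) :
    ∀ᶠ k : ℕ in atTop, ∀ ψ ∈ T, φ f < ψ f → φ (x + k • f) < ψ (x + k • f) :=
  (eventually_all_finite hT).2 fun _ _ =>
    eventually_imp_distrib_left.2 fun h => eventually_map_add_nsmul_lt h x

theorem LowerEnvelopeLE.mem_of_forall_lt (hST : LowerEnvelopeLE S T) (hTS : LowerEnvelopeLE T S)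
    (hS : S.Finite) (hT : T.Finite) (hφ : φ ∈ S) {f : M} (hf : ∀ χ ∈ S, χ ≠ φ → φ f < χ f) :
    φ ∈ T := by
  have hφS : ∀ χ ∈ S, φ f ≤ χ f := fun χ hχ =>
    (eq_or_ne χ φ).elim (fun h => h ▸ le_rfl) fun h => (hf χ hχ h).le
  have hφT : ∀ ψ ∈ T, φ f ≤ ψ f := hST.le_of_forall_le hφS
  suffices φ ∈ {ψ ∈ T | ψ f = φ f} from this.1
  refine mem_of_forall_le_of_forall_exists_le (hT.subset fun _ h => h.1) ?_ fun x => ?_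
  · rintro ψ ⟨hψ, hψf⟩ x
    obtain ⟨k, hk⟩ := (eventually_forall_map_add_nsmul_lt (φ := φ) hS f x).exists
    have hmin : ∀ χ ∈ S, φ (x + k • f) ≤ χ (x + k • f) := fun χ hχ =>
      (eq_or_ne χ φ).elim (fun h => h ▸ le_rfl) fun h => (hk χ hχ (hf χ hχ h)).le
    simpa [hψf] using hST.le_of_forall_le hmin ψ hψ
  · obtain ⟨k, hk⟩ := (eventually_forall_map_add_nsmul_lt (φ := φ) hT f x).exists
    obtain ⟨ψ, hψ, hle⟩ := hTS φ hφ (x + k • f)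
    have hψf : ψ f = φ f :=
      ((hφT ψ hψ).eq_of_not_lt fun h => (hk ψ hψ h).not_ge hle).symm
    exact ⟨ψ, ⟨hψ, hψf⟩, by simpa [hψf] using hle⟩

theorem exists_subset_lowerEnvelopeLE_forall_subset (hS : S.Finite) :
    ∃ T ⊆ S, LowerEnvelopeLE T S ∧ ∀ U : Set (M →+ Γ), U.Finite →
      LowerEnvelopeLE S U → LowerEnvelopeLE U S → T ⊆ U := by
  obtain ⟨T, hTS, ⟨-, hT⟩, hmin⟩ := (hS.finite_subsets.subset
    (t := {T | T ⊆ S ∧ LowerEnvelopeLE T S}) fun _ h => h.1).exists_le_minimal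
      ⟨subset_rfl, .of_subset subset_rfl⟩
  refine ⟨T, hTS, hT, fun U hU hSU hUS φ hφ => ?_⟩
  have hirr : ¬ LowerEnvelopeLE (T \ {φ}) T := fun h =>
    (hmin ⟨Set.sdiff_subset.trans hTS, h.trans hT⟩ Set.sdiff_subset hφ).2 rfl
  obtain ⟨φ', hφ', f, hf⟩ : ∃ φ' ∈ T, ∃ f, ∀ ψ ∈ T \ {φ}, φ' f < ψ f := by
    simpa [LowerEnvelopeLE] using hirr
  obtain rfl : φ' = φ := by
    by_contra hne
    exact (hf φ' ⟨hφ', hne⟩).false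
  exact (hT.trans hSU).mem_of_forall_lt (hUS.trans (.of_subset hTS)) (hS.subset hTS) hU hφ
    fun χ hχ hne => hf χ ⟨hχ, hne⟩

end Archimedean

namespace RealValuation

variable {R : Type*} [CommRing R] [IsLocalRing R] (v : RealValuation R) {I J : Ideal R}

/-- A real valuation as an additive valuation with values in `ℝ≥0∞`, which gives access to the
general theory of additive valuations. -/
noncomputable def toAddValuation : AddValuation R ℝ≥0∞ :=
  .of v v.map_zero v.map_one v.min_le_map_add v.map_mul

theorem map_pow (f : R) (n : ℕ) : v (f ^ n) = n * v f :=
  (v.toAddValuation.map_pow f n).trans (nsmul_eq_mul _ _)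

theorem lt_map_sum {ι : Type*} {s : Finset ι} {F : ι → R} {c : ℝ≥0∞} (hc : c ≠ ⊤)
    (h : ∀ i ∈ s, c < v (F i)) : c < v (∑ i ∈ s, F i) :=
  v.toAddValuation.map_lt_sum hc h

theorem ne_top {f : R} (hf : f ≠ 0) : v f ≠ ⊤ :=
  mt (v.eq_top_iff f).1 hf

theorem onIdeal_le {f : R} (hf : f ∈ I) : v.onIdeal I ≤ v f :=
  iInf₂_le f hf

theorem mem_scaledIdeal {c : ℝ≥0∞} {t : ℝ} {f : R} :
    f ∈ v.scaledIdeal c t ↔ ENNReal.ofReal t * c ≤ v f := Iff.rfl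

theorem le_onIdeal_iff {c : ℝ≥0∞} : c ≤ v.onIdeal I ↔ I ≤ v.scaledIdeal c 1 := by
  simp [onIdeal, SetLike.le_def, mem_scaledIdeal]

theorem onIdeal_top : v.onIdeal ⊤ = 0 :=
  nonpos_iff_eq_zero.1 ((v.onIdeal_le Submodule.mem_top).trans_eq v.map_one)

theorem onIdeal_ne_top (hI : I ≠ ⊥) : v.onIdeal I ≠ ⊤ := by
  obtain ⟨f, hf, hf0⟩ := Submodule.exists_mem_ne_zero_of_ne_bot hI
  exact ne_top_of_le_ne_top (v.ne_top hf0) (v.onIdeal_le hf)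

theorem onIdeal_mul : v.onIdeal (I * J) = v.onIdeal I + v.onIdeal J := by
  apply le_antisymm
  · simp only [onIdeal, ENNReal.iInf_add, ENNReal.add_iInf]
    exact le_iInf₂ fun g hg => le_iInf₂ fun f hf =>
      iInf₂_le_of_le (f * g) (Ideal.mul_mem_mul hf hg) (v.map_mul f g).le
  · rw [le_onIdeal_iff, Ideal.mul_le]
    intro f hf g hg
    rw [mem_scaledIdeal, v.map_mul, ENNReal.ofReal_one, one_mul]
    exact add_le_add (v.onIdeal_le hf) (v.onIdeal_le hg)

theorem onIdeal_pow (m : ℕ) : v.onIdeal (I ^ m) = m * v.onIdeal I := by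
  induction m with
  | zero => simp [Ideal.one_eq_top, onIdeal_top]
  | succ m ih => rw [pow_succ, onIdeal_mul, ih, Nat.cast_succ, add_one_mul]

theorem onFiltration_adicFiltration (hI : IsMPrimary I) :
    v.onFiltration (adicFiltration I hI) = v.onIdeal I := by
  apply Tendsto.limUnder_eq
  have hceil : Tendsto (fun t : ℝ => ENNReal.ofReal (⌈t⌉₊ / t)) atTop (𝓝 1) := by
    simpa using ENNReal.tendsto_ofReal (tendsto_nat_ceil_div_atTop (R := ℝ))
  have hlim := ENNReal.Tendsto.mul_const (b := v.onIdeal I) hceil (Or.inl one_ne_zero)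
  rw [one_mul] at hlim
  refine hlim.congr' ?_
  filter_upwards [eventually_gt_atTop 0] with t ht
  change _ = v.onIdeal (I ^ ⌈t⌉₊) / _
  rw [onIdeal_pow, ENNReal.ofReal_div_of_pos ht, ENNReal.ofReal_natCast, ENNReal.mul_div_right_comm]

theorem onIdeal_le_of_isIntegralOverIdeal {f : R} (hf : IsIntegralOverIdeal I f) :
    v.onIdeal I ≤ v f := by
  obtain ⟨k, -, c, hc, heq⟩ := hf
  by_contra! hlt
  have hfin : v f ≠ ⊤ := hlt.ne_top
  have hterm : ∀ i ∈ Finset.Icc 1 k, v (f ^ k) < v (c i * f ^ (k - i)) := by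
    intro i hi
    obtain ⟨hi1, hik⟩ := Finset.mem_Icc.1 hi
    have hci : i * v f < v (c i) :=
      calc i * v f < i * v.onIdeal I :=
            ENNReal.mul_lt_mul_right (by exact_mod_cast (by omega : i ≠ 0)) (by simp) hlt
        _ = v.onIdeal (I ^ i) := (v.onIdeal_pow i).symm
        _ ≤ v (c i) := v.onIdeal_le (hc i hi)
    calc v (f ^ k) = i * v f + v (f ^ (k - i)) := by
          rw [← Nat.add_sub_cancel' hik, pow_add, v.map_mul, v.map_pow, Nat.add_sub_cancel_left]
      _ < v (c i) + v (f ^ (k - i)) :=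
          ENNReal.add_lt_add_right (by rw [v.map_pow]; exact ENNReal.mul_ne_top (by simp) hfin) hci
      _ = v (c i * f ^ (k - i)) := (v.map_mul _ _).symm
  have hsum := v.lt_map_sum (by rw [v.map_pow]; exact ENNReal.mul_ne_top (by simp) hfin) hterm
  rw [← v.map_neg, neg_eq_of_add_eq_zero_right heq] at hsum
  exact hsum.false

/-- The multiple of `v` with value `1` on `I`, as an additive function on the nonzero elements of a
domain. It is the zero function if `v(I)` is `0` or `∞`. -/
noncomputable def normalized (I : Ideal R) : Additive R⁰ →+ ℝ where
  toFun x := (v (x.toMul : R)).toReal / (v.onIdeal I).toReal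
  map_zero' := by simp [v.map_one]
  map_add' x y := by
    rw [toMul_add, Submonoid.coe_mul, v.map_mul, ENNReal.toReal_add
      (v.ne_top (nonZeroDivisors.coe_ne_zero _)) (v.ne_top (nonZeroDivisors.coe_ne_zero _)),
      add_div]

theorem normalized_apply (x : Additive R⁰) :
    v.normalized I x = (v (x.toMul : R)).toReal / (v.onIdeal I).toReal := rfl

theorem normalized_nonneg (x : Additive R⁰) : 0 ≤ v.normalized I x :=
  div_nonneg ENNReal.toReal_nonneg ENNReal.toReal_nonneg

variable {v}

theorem le_normalized_iff (hI : I ≠ ⊥) (h0 : v.onIdeal I ≠ 0) {t : ℝ} {x : Additive R⁰} :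
    t ≤ v.normalized I x ↔ ENNReal.ofReal t * v.onIdeal I ≤ v (x.toMul : R) := by
  rw [normalized_apply, le_div_iff₀ (ENNReal.toReal_pos h0 (v.onIdeal_ne_top hI)),
    ← ENNReal.ofReal_le_iff_le_toReal (v.ne_top (nonZeroDivisors.coe_ne_zero _)),
    ENNReal.ofReal_mul' ENNReal.toReal_nonneg, ENNReal.ofReal_toReal (v.onIdeal_ne_top hI)]

theorem isEquiv_of_normalized_eq [IsDomain R] {w : RealValuation R} (hI : I ≠ ⊥)
    (hv : v.onIdeal I ≠ 0) (hw : w.onIdeal I ≠ 0) (h : w.normalized I = v.normalized I) :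
    w.IsEquiv v := by
  have hv' := ENNReal.toNNReal_ne_zero.2 ⟨hv, v.onIdeal_ne_top hI⟩
  have hw' := ENNReal.toNNReal_ne_zero.2 ⟨hw, w.onIdeal_ne_top hI⟩
  refine ⟨(v.onIdeal I).toNNReal / (w.onIdeal I).toNNReal, div_ne_zero hv' hw', fun f => ?_⟩
  by_cases hf : f = 0
  · rw [hf, v.map_zero, w.map_zero, ENNReal.mul_top (by simpa using div_ne_zero hv' hw')]
  have hfx : (w f).toNNReal / (w.onIdeal I).toNNReal = (v f).toNNReal / (v.onIdeal I).toNNReal :=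
    NNReal.coe_injective
      (DFunLike.congr_fun h (Additive.ofMul ⟨f, mem_nonZeroDivisors_of_ne_zero hf⟩))
  rw [← ENNReal.coe_toNNReal (v.ne_top hf), ← ENNReal.coe_toNNReal (w.ne_top hf),
    ← ENNReal.coe_mul, ENNReal.coe_inj, div_mul_comm, hfx, div_mul_cancel₀ _ hv']

/-- The normalizations of the members of `S` that are positive on `I`. The other members impose no
condition of the form `t * v(I) ≤ v(f)`. -/
def normalizedSet (I : Ideal R) (S : Set (RealValuation R)) : Set (Additive R⁰ →+ ℝ) :=
  (fun v => v.normalized I) '' {v ∈ S | v.onIdeal I ≠ 0}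

variable {S T : Set (RealValuation R)}

theorem finite_normalizedSet (hS : S.Finite) : (normalizedSet I S).Finite :=
  (hS.subset (Set.sep_subset _ _)).image _

theorem forall_mem_normalizedSet_le_iff (hI : I ≠ ⊥) {t : ℝ} {x : Additive R⁰} :
    (∀ φ ∈ normalizedSet I S, t ≤ φ x) ↔
      ∀ v ∈ S, ENNReal.ofReal t * v.onIdeal I ≤ v (x.toMul : R) := by
  rw [normalizedSet, Set.forall_mem_image]
  refine ⟨fun h v hv => ?_, fun h v hv => (le_normalized_iff hI hv.2).2 (h v hv.1)⟩
  by_cases h0 : v.onIdeal I = 0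
  · simp [h0]
  · exact (le_normalized_iff hI h0).1 (h ⟨hv, h0⟩)

end RealValuation

section ReesValuations

variable {R : Type*} [CommRing R] [IsDomain R] [IsLocalRing R] {I : Ideal R}

theorem IsMPrimary.ne_bot (hI : IsMPrimary I) (hR : ¬ IsField R) : I ≠ ⊥ := by
  rintro rfl
  exact hR (isField_iff_maximalIdeal_eq.2 (hI.2.symm.trans Ideal.isPrime_bot.radical))

theorem RealValuation.IsDivisorial.not_isField {v : RealValuation R} (hv : v.IsDivisorial) :
    ¬ IsField R := by
  intro hR
  obtain ⟨d, -, hd⟩ := hv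
  rw [ringKrullDim_eq_zero_of_isField hR] at hd
  exact d.succ_ne_zero (by exact_mod_cast hd.symm)

open RealValuation

namespace ComputesIntegralClosures

variable {S : Set (RealValuation R)}

theorem isIntegralOverIdeal_pow_iff (hS : ComputesIntegralClosures I S) (hI : I ≠ ⊥) {m : ℕ}
    (hm : 1 ≤ m) {x : Additive R⁰} :
    IsIntegralOverIdeal (I ^ m) (x.toMul : R) ↔ ∀ φ ∈ normalizedSet I S, (m : ℝ) ≤ φ x := by
  rw [hS.2 m hm, forall_mem_normalizedSet_le_iff hI, ENNReal.ofReal_natCast]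

theorem lowerEnvelopeLE_normalizedSet (hS : ComputesIntegralClosures I S) (hfin : S.Finite)
    (hI : I ≠ ⊥) (T : Set (RealValuation R)) :
    LowerEnvelopeLE (normalizedSet I S) (normalizedSet I T) := by
  rintro _ ⟨w, ⟨-, hw⟩, rfl⟩ x
  by_contra! hlt
  set a := w.normalized I x
  have hlarge : ∀ᶠ n : ℕ in atTop,
      ∀ φ ∈ normalizedSet I S, ((⌊n * a⌋₊ + 1 : ℕ) : ℝ) ≤ φ (n • x) := by
    refine (eventually_all_finite (finite_normalizedSet hfin)).2 fun φ hφ => ?_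
    filter_upwards [(tendsto_natCast_atTop_atTop.atTop_mul_const
      (sub_pos.2 (hlt φ hφ))).eventually_ge_atTop 1] with n hn
    have hfloor : (⌊n * a⌋₊ : ℝ) ≤ n * a :=
      Nat.floor_le (mul_nonneg n.cast_nonneg (w.normalized_nonneg x))
    rw [map_nsmul, nsmul_eq_mul, Nat.cast_succ]
    linarith
  obtain ⟨n, hn⟩ := hlarge.exists
  have hint := (hS.isIntegralOverIdeal_pow_iff hI (Nat.le_add_left _ _)).2 hn
  have hle : ((⌊n * a⌋₊ + 1 : ℕ) : ℝ) ≤ w.normalized I (n • x) := by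
    rw [le_normalized_iff hI hw, ENNReal.ofReal_natCast, ← onIdeal_pow]
    exact w.onIdeal_le_of_isIntegralOverIdeal hint
  rw [map_nsmul, nsmul_eq_mul] at hle
  exact hle.not_gt (by exact_mod_cast Nat.lt_floor_add_one (n * a))

theorem lowerEnvelopeLE_normalizedSet_reesValuations (hS : ComputesIntegralClosures I S)
    (hfin : S.Finite) (hI : I ≠ ⊥) (T : Set (RealValuation R)) :
    LowerEnvelopeLE (normalizedSet I (reesValuations I)) (normalizedSet I T) := by
  obtain ⟨Φ, hΦS, hΦ, hunique⟩ :=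
    exists_subset_lowerEnvelopeLE_forall_subset (finite_normalizedSet (I := I) hfin)
  have hΦR : Φ ⊆ normalizedSet I (reesValuations I) := by
    intro φ hφ
    obtain ⟨v, ⟨hv, hv0⟩, rfl⟩ := hΦS hφ
    refine ⟨v, ⟨⟨hS.1 v hv, fun S' hfin' hS' => ?_⟩, hv0⟩, rfl⟩
    obtain ⟨w, ⟨hw, hw0⟩, hwv⟩ := hunique _ (finite_normalizedSet hfin')
      (hS.lowerEnvelopeLE_normalizedSet hfin hI S')
      (hS'.lowerEnvelopeLE_normalizedSet hfin' hI S) hφ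
    exact ⟨w, hw, isEquiv_of_normalized_eq hI hv0 hw0 hwv⟩
  exact (LowerEnvelopeLE.of_subset hΦR).trans
    (hΦ.trans (hS.lowerEnvelopeLE_normalizedSet hfin hI T))

end ComputesIntegralClosures

theorem ofReal_mul_onIdeal_le_of_forall_mem_reesValuations (hI : I ≠ ⊥) {t : ℝ} {f : R}
    (h : ∀ v ∈ reesValuations I, ENNReal.ofReal t * v.onIdeal I ≤ v f)
    {w : RealValuation R} (hw : w.IsDivisorial) : ENNReal.ofReal t * w.onIdeal I ≤ w f := by
  by_cases hex : ∃ S : Set (RealValuation R), S.Finite ∧ ComputesIntegralClosures I S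
  · obtain ⟨S, hfin, hS⟩ := hex
    by_cases hf : f = 0
    · rw [hf, w.map_zero]
      exact le_top
    let x : Additive R⁰ := Additive.ofMul ⟨f, mem_nonZeroDivisors_of_ne_zero hf⟩
    have hRees : ∀ φ ∈ normalizedSet I (reesValuations I), t ≤ φ x :=
      (forall_mem_normalizedSet_le_iff hI).2 h
    exact (forall_mem_normalizedSet_le_iff hI (x := x)).1
      ((hS.lowerEnvelopeLE_normalizedSet_reesValuations hfin hI {w}).le_of_forall_le hRees) w rfl
  · -- With no finite computing set, every divisorial valuation is vacuously a Rees valuation.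
    exact h w ⟨hw, fun S hfin hS => (hex ⟨S, hfin, hS⟩).elim⟩

theorem mem_saturation_adicFiltration_iff (hI : IsMPrimary I) {t : ℝ} {f : R} :
    f ∈ (adicFiltration I hI).saturation t ↔ f ∈ maximalIdeal R ∧
      ∀ v : RealValuation R, v.IsDivisorial → ENNReal.ofReal t * v.onIdeal I ≤ v f := by
  simp only [← onFiltration_adicFiltration _ hI]
  rfl

end ReesValuations

theorem proposition2_general {R : Type*} [CommRing R] [IsDomain R] [IsLocalRing R]
    (𝔞 : Ideal R) (h𝔞 : IsMPrimary 𝔞) (t : ℝ) :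
    (adicFiltration 𝔞 h𝔞).saturation t =
      maximalIdeal R ⊓ ⨅ v ∈ reesValuations 𝔞, v.scaledIdeal (v.onIdeal 𝔞) t := by
  ext f
  simp only [mem_saturation_adicFiltration_iff, Submodule.mem_inf, Submodule.mem_iInf,
    RealValuation.mem_scaledIdeal]
  exact and_congr_right fun _ => ⟨fun h v hv => h v hv.1, fun h w hw =>
    ofReal_mul_onIdeal_le_of_forall_mem_reesValuations (h𝔞.ne_bot hw.not_isField) h hw⟩

theorem proposition2 {R : Type*} [CommRing R] [IsDomain R] [IsLocalRing R] [IsNoetherianRing R]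
    (hR : IsDomain (AdicCompletion (maximalIdeal R) R))
    (𝔞 : Ideal R) (h𝔞 : IsMPrimary 𝔞) (t : ℝ) (ht : 0 < t) :
    (adicFiltration 𝔞 h𝔞).saturation t =
      maximalIdeal R ⊓ ⨅ v ∈ reesValuations 𝔞, v.scaledIdeal (v.onIdeal 𝔞) t :=
  proposition2_general 𝔞 h𝔞 t
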